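/- Let $d\ge 1$, let $x_1,\dots,x_{n_0}\in\mathbb R^d$ be $n_0\ge 2$ initial particles, and let $\psi$ be a random vector in $\mathbb R^d$ with $C:=\mathbb E\|\psi\|<\infty$; put $\hat C:=\mathbb E\min\{\|\psi\|,1\}$. Consider the following continuous-time particle process $(X_t)_{t\ge0}$ with $X_0=\{x_1,\dots,x_{n_0}\}$. From its birth on (from time $0$ for the initial particles), every particle gives birth to new particles at the points of its own Poisson process of intensity $1$, these processes being independent. When a particle located at $x$ gives birth, the new particle is placed at $x+\delta\,\psi'$, where $\delta$ is the distance from the parent to the closest other particle present just before this birth and $\psi'$ is a copy of $\psi$; the copies used at different births are independent of each other and of all the Poisson processes. Particles never move and never die, and they are counted with multiplicity (two distinct particles at the same place are at distance $0$ from each other). Let $d^*_t$ be the maximal spacing of $X_t$, that is, the maximum over the particles present at time $t$ of the distance to the closest other particle present at time $t$. Then $$\limsup_{t\to\infty} e^{(1-\hat C-C)t}\,\mathbb E\, d^*_t<\infty ,$$ i.e. $\mathbb E\,d^*_t=O\big(e^{-(1-C-\hat C)t}\big)$ as $t\to\infty$. (For instance, $d=1$ and $\psi\sim\mathcal N(0,a^2)$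 with $a>0$ is allowed.) -/

import Mathlib

open MeasureTheory ProbabilityTheory

namespace LISA

/-- Genealogical names of the particles of a population started by `n` ancestors.
`(i, [])` is the `i`-th initial particle, and `(i, j :: p)` is the `j`-th child, in order of
appearance and counted from `0`, of the particle `(i, p)`. -/
abbrev Label (n : ℕ) : Type := Fin n × List ℕ

/-- Birth time of a descendant of the `i`-th initial particle. Initial particles are present at
time `0`. Once born, a particle `u` has its children at the successive points of its own point
process on the half-line (time being counted from the birth of `u`), whose successive gaps are
`gap u 0, gap u 1, …`. If these gaps are independent and exponentially distributed with
parameter `1`, this point process is the Poisson process of intensity `1`. -/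
noncomputable def birthAux {n : ℕ} (gap : Label n → ℕ → ℝ) (i : Fin n) : List ℕ → ℝ
  | [] => 0
  | j :: p => birthAux gap i p + ∑ l ∈ Finset.range (j + 1), gap (i, p) l

/-- Birth time of the particle `u`. -/
noncomputable def birth {n : ℕ} (gap : Label n → ℕ → ℝ) (u : Label n) : ℝ :=
  birthAux gap u.1 u.2

/-- The particles born strictly before the birth of `u`. -/
def bornBefore {n : ℕ} (gap : Label n → ℕ → ℝ) (u : Label n) : Set (Label n) :=
  {v | birth gap v < birth gap u}

theorem ncard_bornBefore_lt {n : ℕ} {gap : Label n → ℕ → ℝ} {u v : Label n}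
    (hu : (bornBefore gap u).Finite) (hv : birth gap v < birth gap u) :
    (bornBefore gap v).ncard < (bornBefore gap u).ncard := by
  refine Set.ncard_lt_ncard ⟨fun w hw => lt_trans hw hv, fun h => ?_⟩ hu
  exact lt_irrefl (birth gap v) (h hv)

/-- Position of the particle `u`, when the initial particles are at `x₀ 0, …, x₀ (n - 1)`.
The `j`-th child of a particle `m` is put at `x_m + δ • mark m j`, where `x_m` is the position of
`m` and `δ` is the distance from `m` to the closest other particle among those present just
before the birth of the child.
The side condition says that finitely many particles, the mother among them, were born
before the child; the last branch is a convention for the event of probability zero that this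
fails. -/
noncomputable def position {n d : ℕ} (x₀ : Fin n → EuclideanSpace ℝ (Fin d))
    (gap : Label n → ℕ → ℝ) (mark : Label n → ℕ → EuclideanSpace ℝ (Fin d)) :
    Label n → EuclideanSpace ℝ (Fin d)
  | (i, []) => x₀ i
  | (i, j :: p) =>
    open Classical in
    if _h : (bornBefore gap (i, j :: p)).Finite ∧ (i, p) ∈ bornBefore gap (i, j :: p) then
      position x₀ gap mark (i, p) +
        (⨅ (v : Label n) (_ : v ∈ bornBefore gap (i, j :: p) ∧ v ≠ (i, p)),
          edist (position x₀ gap mark (i, p)) (position x₀ gap mark v)).toReal • mark (i, p) j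
    else x₀ i
termination_by u => (bornBefore gap u).ncard
decreasing_by
  all_goals
    refine ncard_bornBefore_lt _h.1 ?_
    first
      | exact _h.2
      | exact (by assumption : _ ∧ _).1

theorem position_initial {n d : ℕ} (x₀ : Fin n → EuclideanSpace ℝ (Fin d))
    (gap : Label n → ℕ → ℝ) (mark : Label n → ℕ → EuclideanSpace ℝ (Fin d)) (i : Fin n) :
    position x₀ gap mark (i, []) = x₀ i := by
  rw [position]

theorem position_child {n d : ℕ} (x₀ : Fin n → EuclideanSpace ℝ (Fin d))
    (gap : Label n → ℕ → ℝ) (mark : Label n → ℕ → EuclideanSpace ℝ (Fin d))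
    (i : Fin n) (p : List ℕ) (j : ℕ) (hfin : (bornBefore gap (i, j :: p)).Finite)
    (hpos : birth gap (i, p) < birth gap (i, j :: p)) :
    position x₀ gap mark (i, j :: p) = position x₀ gap mark (i, p) +
      (⨅ (v : Label n) (_ : birth gap v < birth gap (i, j :: p) ∧ v ≠ (i, p)),
        edist (position x₀ gap mark (i, p)) (position x₀ gap mark v)).toReal • mark (i, p) j := by
  rw [position, dif_pos ⟨hfin, hpos⟩]
  rfl

/-- The particles present at time `t`. -/
def alive {n : ℕ} (gap : Label n → ℕ → ℝ) (t : ℝ) : Set (Label n) :=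
  {u | birth gap u ≤ t}

/-- The maximal spacing at time `t`: the maximum over the particles present at time `t` of the
distance to the closest other particle present at time `t`. -/
noncomputable def maxSpacing {n d : ℕ} (x₀ : Fin n → EuclideanSpace ℝ (Fin d))
    (gap : Label n → ℕ → ℝ) (mark : Label n → ℕ → EuclideanSpace ℝ (Fin d)) (t : ℝ) : ENNReal :=
  ⨆ u ∈ alive gap t, ⨅ (v : Label n) (_ : v ∈ alive gap t ∧ v ≠ u),
    edist (position x₀ gap mark u) (position x₀ gap mark v)

/-- The randomness of the continuous-time model: all the gaps `gap u j` and all the marks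
`mark u j` are independent, the gaps have the exponential distribution with parameter `1`
(so that every particle reproduces at the points of its own Poisson process of
intensity `1`), and the marks have distribution `μ`. -/
structure IsDriving {n d : ℕ} {Ω : Type*} [MeasurableSpace Ω] (P : Measure Ω)
    (μ : Measure (EuclideanSpace ℝ (Fin d)))
    (gap : Label n → ℕ → Ω → ℝ) (mark : Label n → ℕ → Ω → EuclideanSpace ℝ (Fin d)) : Prop where
  measurable_gap : ∀ u j, Measurable (gap u j)
  measurable_mark : ∀ u j, Measurable (mark u j)
  map_pair : ∀ u j, P.map (fun ω => (gap u j ω, mark u j ω)) = (expMeasure 1).prod μ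
  indep : iIndepFun (fun (k : Label n × ℕ) (ω : Ω) => (gap k.1 k.2 ω, mark k.1 k.2 ω)) P

end LISA

namespace LISA

open scoped ENNReal

/-! Record a particle together with its number of children as a state. At each birth the state of
the mother splits in two: the mother with one more child, and the newborn. The states thus form
binary trees, one rooted at each initial particle, whose nodes are words in `Bool`. If the spacing
of the mother is at most `δ` and the mark is `y`, the child lies within `δ‖y‖` of her, so afterwards
her spacing is at most `δ * min ‖y‖ 1` and that of the child at most `δ‖y‖` (`spacing_arrival_le`).
Hence the maximal spacing at time `t` is at most a constant times the sum, over all states current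
at `t`, of the products of these factors along the path from the root (`maxSpacing_le`). A path of
length `m` uses `m` independent exponential gaps, and the marks are independent of the gaps. Its end
is therefore current at `t` with Poisson probability `e^{-t} t^m / m!`, and the expected weights of
the words of length `m` add up to `(C + Ĉ)^m` (`lintegral_state`, `lintegral_tsum_current`). Summing
over `m` gives `e^{-(1 - C - Ĉ) t}` for each root. -/

/-- The time at which `k.1` has had its first `k.2` children. -/
noncomputable def arrival {n : ℕ} (gap : Label n → ℕ → ℝ) (k : Label n × ℕ) : ℝ :=
  birth gap k.1 + ∑ l ∈ Finset.range k.2, gap k.1 l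

/-- The two states reached from the state "particle `k.1` with `k.2` children" when the next child
is born: stay with the mother (`false`) or follow the child (`true`). -/
def step {n : ℕ} (b : Bool) (k : Label n × ℕ) : Label n × ℕ :=
  bif b then ((k.1.1, k.2 :: k.1.2), 0) else (k.1, k.2 + 1)

/-- The state reached from the `i`-th initial particle by following a word (read from the right). -/
def state {n : ℕ} (i : Fin n) (w : List Bool) : Label n × ℕ :=
  w.foldr step ((i, []), 0)

/-- The number of steps needed to reach a state. -/
def depth {n : ℕ} (k : Label n × ℕ) : ℕ :=
  (k.1.2.map Nat.succ).sum + k.2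

/-- The multiplicative weight of a newborn particle: a factor `φ false` for each elder sibling of
an ancestor or of itself, a factor `φ true` for each filiation. -/
noncomputable def birthWeight {n : ℕ} {E : Type*} (φ : Bool → E → ℝ≥0∞)
    (mark : Label n → ℕ → E) (i : Fin n) : List ℕ → ℝ≥0∞
  | [] => 1
  | j :: p => birthWeight φ mark i p * (∏ l ∈ Finset.range j, φ false (mark (i, p) l)) *
      φ true (mark (i, p) j)

/-- The multiplicative weight of a state. -/
noncomputable def weight {n : ℕ} {E : Type*} (φ : Bool → E → ℝ≥0∞)
    (mark : Label n → ℕ → E) (k : Label n × ℕ) : ℝ≥0∞ :=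
  birthWeight φ mark k.1.1 k.1.2 * ∏ l ∈ Finset.range k.2, φ false (mark k.1 l)

/-! ### The binary tree of states. -/

section Deterministic

variable {n : ℕ}

theorem birth_child (gap : Label n → ℕ → ℝ) (i : Fin n) (p : List ℕ) (j : ℕ) :
    birth gap (i, j :: p) = arrival gap ((i, p), j + 1) := rfl

theorem arrival_succ (gap : Label n → ℕ → ℝ) (u : Label n) (j : ℕ) :
    arrival gap (u, j + 1) = arrival gap (u, j) + gap u j := by
  simp [arrival, Finset.sum_range_succ, add_assoc]

theorem arrival_zero (gap : Label n → ℕ → ℝ) (u : Label n) :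
    arrival gap (u, 0) = birth gap u := by
  simp [arrival]

theorem arrival_initial (gap : Label n → ℕ → ℝ) (i : Fin n) :
    arrival gap ((i, []), 0) = 0 := by
  simp [arrival, birth, birthAux]

theorem arrival_step (gap : Label n → ℕ → ℝ) (b : Bool) (k : Label n × ℕ) :
    arrival gap (step b k) = arrival gap k + gap k.1 k.2 := by
  obtain ⟨⟨i, p⟩, j⟩ := k
  cases b
  · exact arrival_succ gap _ _
  · simp only [step, cond_true]
    rw [arrival_zero, birth_child, arrival_succ]

theorem depth_step (b : Bool) (k : Label n × ℕ) : depth (step b k) = depth k + 1 := by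
  cases b <;> simp [depth, step] <;> omega

theorem weight_initial {E : Type*} (φ : Bool → E → ℝ≥0∞) (mark : Label n → ℕ → E) (i : Fin n) :
    weight φ mark ((i, []), 0) = 1 := by
  simp [weight, birthWeight]

theorem weight_step {E : Type*} (φ : Bool → E → ℝ≥0∞) (mark : Label n → ℕ → E) (b : Bool)
    (k : Label n × ℕ) : weight φ mark (step b k) = weight φ mark k * φ b (mark k.1 k.2) := by
  obtain ⟨⟨i, p⟩, j⟩ := k
  cases b <;> simp [weight, step, birthWeight, Finset.prod_range_succ, mul_assoc]

/-- With trivial factors the formula for expected weights becomes one for the arrival times alone,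
which is what non-explosion requires. -/
theorem weight_const_one {E : Type*} (mark : Label n → ℕ → E) (k : Label n × ℕ) :
    weight (fun _ _ => 1) mark k = 1 := by
  obtain ⟨⟨i, p⟩, j⟩ := k
  have h : birthWeight (fun _ _ => 1) mark i p = 1 := by
    induction p with
    | nil => rfl
    | cons j p ih => simp [birthWeight, ih]
  simp [weight, h]

theorem state_cons (i : Fin n) (b : Bool) (w : List Bool) :
    state i (b :: w) = step b (state i w) := rfl

theorem exists_state (k : Label n × ℕ) : ∃ i w, state i w = k := by
  obtain ⟨⟨i, p⟩, j⟩ := k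
  refine ⟨i, ?_⟩
  induction p generalizing j with
  | nil =>
    induction j with
    | zero => exact ⟨[], rfl⟩
    | succ j ih =>
      obtain ⟨w, hw⟩ := ih
      exact ⟨false :: w, by rw [state_cons, hw]; rfl⟩
  | cons m p ihp =>
    induction j with
    | zero =>
      obtain ⟨w, hw⟩ := ihp m
      exact ⟨true :: w, by rw [state_cons, hw]; rfl⟩
    | succ j ih =>
      obtain ⟨w, hw⟩ := ih
      exact ⟨false :: w, by rw [state_cons, hw]; rfl⟩

/-! ### Pathwise bounds on spacings. -/

/-- The factors bounding the spacings after a birth: at most `min ‖y‖ 1` times the former spacing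
for the mother, at most `‖y‖` times this spacing for the child. -/
noncomputable def spacingFactor {E : Type*} [ENorm E] (b : Bool) (y : E) : ℝ≥0∞ :=
  bif b then ‖y‖ₑ else min ‖y‖ₑ 1

/-- Distance from `u` to the closest other particle among those born up to time `t`. -/
noncomputable def spacing {d : ℕ} (x₀ : Fin n → EuclideanSpace ℝ (Fin d))
    (gap : Label n → ℕ → ℝ) (mark : Label n → ℕ → EuclideanSpace ℝ (Fin d)) (t : ℝ)
    (u : Label n) : ℝ≥0∞ :=
  ⨅ (v : Label n) (_ : v ∈ alive gap t ∧ v ≠ u),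
    edist (position x₀ gap mark u) (position x₀ gap mark v)

variable {d : ℕ} {x₀ : Fin n → EuclideanSpace ℝ (Fin d)} {gap : Label n → ℕ → ℝ}
  {mark : Label n → ℕ → EuclideanSpace ℝ (Fin d)}

theorem spacing_anti (u : Label n) {s t : ℝ} (h : s ≤ t) :
    spacing x₀ gap mark t u ≤ spacing x₀ gap mark s u :=
  le_iInf₂ fun v hv => iInf₂_le v ⟨le_trans (hv.1 : birth gap v ≤ s) h, hv.2⟩

theorem birth_le_arrival (hgap : ∀ u j, 0 < gap u j) (k : Label n × ℕ) :
    birth gap k.1 ≤ arrival gap k :=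
  le_add_of_nonneg_right (Finset.sum_nonneg fun _ _ => (hgap _ _).le)

theorem finite_alive (hfin : ∀ t, {k : Label n × ℕ | arrival gap k ≤ t}.Finite) (t : ℝ) :
    (alive gap t).Finite := by
  refine ((hfin t).image Prod.fst).subset fun u hu => ⟨(u, 0), ?_, rfl⟩
  simpa [arrival_zero] using! hu

/-- Every particle present at the mother's previous arrival is born strictly before the child, so
the infimum defining the displacement runs over at least those particles. -/
theorem edist_child_le (hgap : ∀ u j, 0 < gap u j)
    (hfin : ∀ t, {k : Label n × ℕ | arrival gap k ≤ t}.Finite) (i : Fin n) (p : List ℕ) (j : ℕ) :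
    edist (position x₀ gap mark (i, p)) (position x₀ gap mark (i, j :: p)) ≤
      spacing x₀ gap mark (arrival gap ((i, p), j)) (i, p) * ‖mark (i, p) j‖ₑ := by
  have hlt : arrival gap ((i, p), j) < birth gap (i, j :: p) := by
    rw [birth_child, arrival_succ]; exact lt_add_of_pos_right _ (hgap _ _)
  rw [position_child x₀ gap mark i p j
    ((finite_alive hfin _).subset fun v (hv : birth gap v < birth gap (i, j :: p)) => hv.le)
    ((birth_le_arrival hgap ((i, p), j)).trans_lt hlt), edist_comm, edist_eq_enorm_sub,
    add_sub_cancel_left, enorm_smul]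
  gcongr
  rw [Real.enorm_of_nonneg ENNReal.toReal_nonneg]
  -- If the infimum were infinite, `toReal` would replace it by `0`, which only helps an upper
  -- bound.
  refine ENNReal.ofReal_toReal_le.trans (le_iInf₂ fun v hv => iInf₂_le v ⟨?_, hv.2⟩)
  exact lt_of_le_of_lt (hv.1 : birth gap v ≤ _) hlt

/-- Induction along the word. After a birth, the mother may use either the child or her former
neighbour, whence the minimum with `1`; the child can only use the mother. At the root, a second
initial particle exists and the sum over all pairs dominates its distance. -/
theorem spacing_arrival_le (hn : 2 ≤ n) (hgap : ∀ u j, 0 < gap u j)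
    (hfin : ∀ t, {k : Label n × ℕ | arrival gap k ≤ t}.Finite) (i : Fin n) (w : List Bool) :
    spacing x₀ gap mark (arrival gap (state i w)) (state i w).1 ≤
      (∑ a, ∑ b, edist (x₀ a) (x₀ b)) * weight spacingFactor mark (state i w) := by
  induction w with
  | nil =>
    have : Nontrivial (Fin n) := Fin.nontrivial_iff_two_le.2 hn
    obtain ⟨i', hi'⟩ := exists_ne i
    change spacing x₀ gap mark (arrival gap ((i, []), 0)) (i, []) ≤
      _ * weight spacingFactor mark ((i, []), 0)
    rw [weight_initial, mul_one, arrival_initial]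
    refine (iInf₂_le (i', []) ⟨le_refl (0 : ℝ), by simpa using hi'⟩).trans ?_
    rw [position_initial, position_initial]
    exact (Finset.single_le_sum (f := fun b => edist (x₀ i) (x₀ b)) (fun _ _ => zero_le)
      (Finset.mem_univ i')).trans (Finset.single_le_sum
        (f := fun a => ∑ b, edist (x₀ a) (x₀ b)) (fun _ _ => zero_le) (Finset.mem_univ i))
  | cons b w ih =>
    rw [state_cons, weight_step, ← mul_assoc]
    generalize state i w = k at ih ⊢
    obtain ⟨⟨i', p⟩, j⟩ := k
    refine le_trans ?_ (mul_le_mul_left ih _)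
    have hle : arrival gap ((i', p), j) ≤ arrival gap (step b ((i', p), j)) := by
      rw [arrival_step]; exact le_add_of_nonneg_right (hgap _ _).le
    have hchild := edist_child_le (x₀ := x₀) (mark := mark) hgap hfin i' p j
    have hbirth : birth gap (i', j :: p) ≤ arrival gap (step b ((i', p), j)) := by
      rw [birth_child, arrival_succ, arrival_step]
    cases b
    · simp only [spacingFactor, cond_false, mul_min, mul_one]
      refine le_min (le_trans (iInf₂_le (i', j :: p) ⟨hbirth, ?_⟩) hchild) (spacing_anti _ hle)
      simp [step]
    · simp only [spacingFactor, cond_true]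
      refine le_trans (iInf₂_le (i', p) ⟨(birth_le_arrival hgap ((i', p), j)).trans hle, ?_⟩) ?_
      · rw [edist_comm]; exact hchild
      · simp [step]

theorem exists_arrival_le_lt (hfin : ∀ t, {k : Label n × ℕ | arrival gap k ≤ t}.Finite)
    {t : ℝ} {u : Label n} (hu : u ∈ alive gap t) :
    ∃ j, arrival gap (u, j) ≤ t ∧ t < arrival gap (u, j) + gap u j := by
  have hex : ∃ j, t < arrival gap (u, j) := by
    by_contra! h
    exact Set.infinite_range_of_injective (Prod.mk_right_injective u)
      ((hfin t).subset (by rintro _ ⟨j, rfl⟩; exact h j))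
  classical
  obtain ⟨j, hj⟩ : ∃ j, Nat.find hex = j + 1 := by
    refine Nat.exists_eq_succ_of_ne_zero fun h0 => ?_
    have := Nat.find_spec hex
    rw [h0, arrival_zero] at this
    exact absurd (hu : birth gap u ≤ t) (not_le.2 this)
  refine ⟨j, not_lt.1 (Nat.find_min hex (by omega)), ?_⟩
  rw [← arrival_succ, ← hj]
  exact Nat.find_spec hex

/-- The maximal spacing is dominated by a sum of weights over the current states. -/
theorem maxSpacing_le (hn : 2 ≤ n) (hgap : ∀ u j, 0 < gap u j)
    (hfin : ∀ t, {k : Label n × ℕ | arrival gap k ≤ t}.Finite) (t : ℝ) :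
    maxSpacing x₀ gap mark t ≤ (∑ a, ∑ b, edist (x₀ a) (x₀ b)) *
      ∑ i, ∑' w : List Bool,
        {z : ℝ × ℝ | z.1 ≤ t ∧ t < z.1 + z.2}.indicator 1
          (arrival gap (state i w), gap (state i w).1 (state i w).2) *
        weight spacingFactor mark (state i w) := by
  refine iSup₂_le fun u hu => ?_
  -- Here `j` is the number of children of `u` at time `t`. The spacing has not grown since the last
  -- of these births (or since the birth of `u`), and the supremum is bounded by the sum because
  -- this state contributes one of its terms.
  obtain ⟨j, hj⟩ := exists_arrival_le_lt hfin hu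
  obtain ⟨i, w, hw⟩ := exists_state (u, j)
  have h := spacing_arrival_le (x₀ := x₀) (mark := mark) hn hgap hfin i w
  rw [hw] at h
  refine (spacing_anti u hj.1).trans (h.trans ?_)
  gcongr
  refine le_trans (le_trans ?_ (ENNReal.le_tsum w)) (Finset.single_le_sum
    (f := fun i => ∑' w : List Bool,
        {z : ℝ × ℝ | z.1 ≤ t ∧ t < z.1 + z.2}.indicator 1
          (arrival gap (state i w), gap (state i w).1 (state i w).2) *
        weight spacingFactor mark (state i w)) (fun _ _ => zero_le) (Finset.mem_univ i))
  rw [hw, Set.indicator_of_mem (by exact hj)]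
  simp

end Deterministic

/-- Grouping words by length `m` and expanding the `m`-th power of `c true + c false` gives one
product per word. -/
theorem tsum_list_bool (c : Bool → ℝ≥0∞) (q : ℕ → ℝ≥0∞) :
    ∑' w : List Bool, (w.map c).prod * q w.length = ∑' m, (c true + c false) ^ m * q m := by
  rw [← List.equivSigmaTuple.symm.tsum_eq, ENNReal.tsum_sigma']
  refine tsum_congr fun m => ?_
  rw [tsum_fintype]
  simp only [List.equivSigmaTuple, Equiv.coe_fn_symm_mk, List.length_ofFn, List.map_ofFn,
    List.prod_ofFn, Function.comp_apply]
  rw [← Finset.sum_mul, ← Fintype.piFinset_univ, ← Finset.prod_univ_sum]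
  simp

/-! ### Exponential increments and Poisson probabilities. -/

section Exponential

theorem lintegral_expMeasure_one (f : ℝ → ℝ≥0∞) (hf : Measurable f) :
    ∫⁻ y, f y ∂expMeasure 1 = ∫⁻ y in Set.Ici 0, ENNReal.ofReal (Real.exp (-y)) * f y := by
  have hm : Measurable (gammaPDF 1 1) := (measurable_exponentialPDFReal 1).ennreal_ofReal
  rw [expMeasure, gammaMeasure, lintegral_withDensity_eq_lintegral_mul _ hm hf,
    ← lintegral_indicator measurableSet_Ici]
  refine lintegral_congr fun y => ?_
  change exponentialPDF 1 y * f y = _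
  by_cases hy : 0 ≤ y
  · rw [Set.indicator_of_mem (by exact hy), exponentialPDF_of_nonneg hy]
    simp
  · rw [Set.indicator_of_notMem (by exact hy), exponentialPDF_of_neg (not_le.1 hy), zero_mul]

theorem ae_pos_expMeasure_one : ∀ᵐ y ∂expMeasure 1, 0 < y := by
  rw [ae_iff, ← lintegral_indicator_one (by measurability),
    lintegral_expMeasure_one _ (measurable_one.indicator (by measurability)),
    setLIntegral_congr Ioi_ae_eq_Ici.symm]
  refine (setLIntegral_congr_fun measurableSet_Ioi (g := 0) fun y hy => ?_).trans (by simp)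
  rw [Set.indicator_of_notMem (by simpa using hy)]
  simp

/-- The mean of `g` after an exponential increment. -/
noncomputable def expStep (g : ℝ → ℝ≥0∞) (x : ℝ) : ℝ≥0∞ :=
  ∫⁻ y, g (x + y) ∂expMeasure 1

instance : IsProbabilityMeasure (expMeasure 1) := isProbabilityMeasure_expMeasure one_pos

theorem measurable_expStep {g : ℝ → ℝ≥0∞} (hg : Measurable g) : Measurable (expStep g) :=
  Measurable.lintegral_prod_right' (f := fun z : ℝ × ℝ => g (z.1 + z.2)) (by fun_prop)

theorem expStep_const_mul (c : ℝ≥0∞) {g : ℝ → ℝ≥0∞} (hg : Measurable g) :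
    expStep (fun x => c * g x) = fun x => c * expStep g x := by
  funext x
  exact lintegral_const_mul c (by fun_prop)

/-- The probability that `m` exponential increments after `x` do not exceed `t`
while `m + 1` do. -/
noncomputable def poissonTail (t : ℝ) (m : ℕ) (x : ℝ) : ℝ≥0∞ :=
  (Set.Iic t).indicator (fun x => ENNReal.ofReal (Real.exp (-(t - x)) * (t - x) ^ m / m.factorial)) x

theorem measurable_poissonTail (t : ℝ) (m : ℕ) : Measurable (poissonTail t m) :=
  Measurable.indicator (by fun_prop) measurableSet_Iic

/-- The two exponential factors combine into `e^{-(t - x)}`, which does not depend on the increment;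
what remains is the integral of `(t - x - y)^m / m!` over `0 ≤ y ≤ t - x`. -/
theorem expStep_poissonTail (t : ℝ) (m : ℕ) :
    expStep (poissonTail t m) = poissonTail t (m + 1) := by
  funext x
  have hm := measurable_poissonTail t m
  rw [expStep, lintegral_expMeasure_one (fun y => poissonTail t m (x + y)) (by fun_prop)]
  by_cases hx : x ≤ t
  · have h1 : ∫⁻ y in Set.Ici 0, ENNReal.ofReal (Real.exp (-y)) * poissonTail t m (x + y) =
        ∫⁻ y in Set.Ioc 0 (t - x), ENNReal.ofReal
          (Real.exp (-(t - x)) * (t - x - y) ^ m / m.factorial) := by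
      rw [setLIntegral_congr Ioc_ae_eq_Icc, ← lintegral_indicator measurableSet_Ici,
        ← lintegral_indicator measurableSet_Icc]
      refine lintegral_congr fun y => ?_
      by_cases hy : 0 ≤ y
      · rw [Set.indicator_of_mem (by exact hy)]
        by_cases hy' : y ≤ t - x
        · rw [Set.indicator_of_mem (by exact ⟨hy, hy'⟩), poissonTail,
            Set.indicator_of_mem (by simp; linarith), ← ENNReal.ofReal_mul (Real.exp_pos _).le,
            mul_div_assoc, ← mul_assoc, ← Real.exp_add]
          ring_nf
        · rw [Set.indicator_of_notMem (fun h => hy' h.2), poissonTail,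
            Set.indicator_of_notMem (by simp; linarith), mul_zero]
      · rw [Set.indicator_of_notMem (by exact hy), Set.indicator_of_notMem (fun h => hy h.1)]
    have hx' : 0 ≤ t - x := sub_nonneg.2 hx
    rw [h1, ← ofReal_integral_eq_lintegral_ofReal, poissonTail,
      Set.indicator_of_mem (by exact hx), ← intervalIntegral.integral_of_le hx']
    · congr 1
      simp only [mul_div_assoc]
      rw [intervalIntegral.integral_const_mul, intervalIntegral.integral_div,
        intervalIntegral.integral_comp_sub_left (fun y => y ^ m), integral_pow]
      congr 1
      rw [Nat.factorial_succ]
      push_cast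
      field_simp
      simp
    · exact (Continuous.integrableOn_Icc (by fun_prop)).mono_set Set.Ioc_subset_Icc_self
    · filter_upwards [ae_restrict_mem measurableSet_Ioc] with y hy
      have : 0 ≤ t - x - y := sub_nonneg.2 hy.2
      positivity
  · rw [poissonTail, Set.indicator_of_notMem (by exact hx)]
    refine (setLIntegral_congr_fun measurableSet_Ici (g := 0) fun y (hy : 0 ≤ y) => ?_).trans
      (by simp)
    change _ * Set.indicator _ _ _ = _
    rw [Set.indicator_of_notMem (by simp; linarith)]
    simp

theorem iterate_expStep_poissonTail (t : ℝ) (m : ℕ) :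
    expStep^[m] (poissonTail t 0) = poissonTail t m := by
  induction m with
  | zero => rfl
  | succ m ih => rw [Function.iterate_succ_apply', ih, expStep_poissonTail]

theorem measurable_indicator_current (t : ℝ) :
    Measurable ({z : ℝ × ℝ | z.1 ≤ t ∧ t < z.1 + z.2}.indicator (1 : ℝ × ℝ → ℝ≥0∞)) :=
  measurable_one.indicator ((measurableSet_le measurable_fst measurable_const).inter
    (measurableSet_lt measurable_const (measurable_fst.add measurable_snd)))

theorem lintegral_indicator_expMeasure_one (t x : ℝ) :
    ∫⁻ y, {z : ℝ × ℝ | z.1 ≤ t ∧ t < z.1 + z.2}.indicator 1 (x, y) ∂expMeasure 1 =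
      poissonTail t 0 x := by
  have hm := measurable_indicator_current t
  rw [lintegral_expMeasure_one
    (fun y => {z : ℝ × ℝ | z.1 ≤ t ∧ t < z.1 + z.2}.indicator 1 (x, y)) (by fun_prop)]
  by_cases hx : x ≤ t
  · have h1 : ∫⁻ y in Set.Ici 0, ENNReal.ofReal (Real.exp (-y)) *
          {z : ℝ × ℝ | z.1 ≤ t ∧ t < z.1 + z.2}.indicator 1 (x, y) =
        ∫⁻ y in Set.Ioi (t - x), ENNReal.ofReal (Real.exp (-y)) := by
      rw [← lintegral_indicator measurableSet_Ici, ← lintegral_indicator measurableSet_Ioi]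
      refine lintegral_congr fun y => ?_
      by_cases hy : t - x < y
      · have : (x, y) ∈ {z : ℝ × ℝ | z.1 ≤ t ∧ t < z.1 + z.2} := ⟨hx, sub_lt_iff_lt_add'.1 hy⟩
        rw [Set.indicator_of_mem (s := Set.Ici 0) ((sub_nonneg.2 hx).trans hy.le),
          Set.indicator_of_mem this, Set.indicator_of_mem (s := Set.Ioi _) hy]
        simp
      · rw [Set.indicator_of_notMem (s := Set.Ioi _) (by exact hy)]
        have : (x, y) ∉ {z : ℝ × ℝ | z.1 ≤ t ∧ t < z.1 + z.2} := fun h => hy (by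
          have := h.2; simp at this; linarith)
        by_cases hy' : 0 ≤ y
        · rw [Set.indicator_of_mem (by exact hy'), Set.indicator_of_notMem this, mul_zero]
        · rw [Set.indicator_of_notMem (by exact hy')]
    rw [h1, ← ofReal_integral_eq_lintegral_ofReal _ (ae_of_all _ fun y => (Real.exp_pos _).le),
      integral_exp_neg_Ioi, poissonTail, Set.indicator_of_mem (by exact hx)]
    · simp
    · simpa [IntegrableOn] using exp_neg_integrableOn_Ioi (t - x) one_pos
  · rw [poissonTail, Set.indicator_of_notMem (by exact hx)]
    simp [Set.indicator, hx]

/-- The factor is the Laplace transform `1 / (1 + 3)` of the increment. The rate `3` makes it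
smaller than `1/2`, so that it beats the two successors of each state. -/
theorem expStep_exp :
    expStep (fun x => ENNReal.ofReal (Real.exp (-(3 * x)))) =
      fun x => 4⁻¹ * ENNReal.ofReal (Real.exp (-(3 * x))) := by
  funext x
  rw [expStep, lintegral_expMeasure_one _ (by fun_prop), setLIntegral_congr Ioi_ae_eq_Ici.symm]
  have h1 : ∀ y : ℝ, ENNReal.ofReal (Real.exp (-y)) * ENNReal.ofReal (Real.exp (-(3 * (x + y)))) =
      ENNReal.ofReal (Real.exp (-(3 * x))) * ENNReal.ofReal (Real.exp (-4 * y)) := fun y => by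
    rw [← ENNReal.ofReal_mul (Real.exp_pos _).le, ← ENNReal.ofReal_mul (Real.exp_pos _).le,
      ← Real.exp_add, ← Real.exp_add]
    ring_nf
  simp only [h1]
  rw [lintegral_const_mul _ (by fun_prop), ← ofReal_integral_eq_lintegral_ofReal
    (exp_neg_integrableOn_Ioi 0 (by norm_num)) (ae_of_all _ fun y => (Real.exp_pos _).le),
    integral_exp_mul_Ioi (by norm_num), mul_comm]
  congr 1
  rw [mul_zero, Real.exp_zero, show (-1 / -4 : ℝ) = 4⁻¹ by norm_num,
    ENNReal.ofReal_inv_of_pos (by norm_num)]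
  simp

theorem iterate_expStep_exp (m : ℕ) :
    expStep^[m] (fun x => ENNReal.ofReal (Real.exp (-(3 * x)))) =
      fun x => 4⁻¹ ^ m * ENNReal.ofReal (Real.exp (-(3 * x))) := by
  induction m with
  | zero => simp
  | succ m ih =>
    rw [Function.iterate_succ_apply', ih, expStep_const_mul _ (by fun_prop), expStep_exp]
    simp only [pow_succ, mul_assoc]

theorem tsum_pow_mul_poissonTail {r t : ℝ} (hr : 0 ≤ r) (ht : 0 ≤ t) :
    ∑' m, ENNReal.ofReal r ^ m * poissonTail t m 0 = ENNReal.ofReal (Real.exp (-(1 - r) * t)) := by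
  have h : ∀ m : ℕ, ENNReal.ofReal r ^ m * poissonTail t m 0 =
      ENNReal.ofReal (Real.exp (-t) * ((r * t) ^ m / m.factorial)) := fun m => by
    rw [poissonTail, Set.indicator_of_mem (by exact ht), ← ENNReal.ofReal_pow hr,
      ← ENNReal.ofReal_mul (by positivity)]
    congr 1
    rw [sub_zero, mul_pow]
    ring
  have hs : HasSum (fun m : ℕ => Real.exp (-t) * ((r * t) ^ m / m.factorial))
      (Real.exp (-t) * Real.exp (r * t)) := by
    rw [Real.exp_eq_exp_ℝ]
    exact (NormedSpace.expSeries_div_hasSum_exp (r * t)).mul_left _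
  rw [tsum_congr h, ← ENNReal.ofReal_tsum_of_nonneg (fun m => by positivity) hs.summable,
    hs.tsum_eq, ← Real.exp_add]
  ring_nf

end Exponential

/-! ### Independence along paths and expected weights. -/

section Probability

variable {n d : ℕ} {Ω : Type*} {gap : Label n → ℕ → Ω → ℝ}
  {mark : Label n → ℕ → Ω → EuclideanSpace ℝ (Fin d)}
  {φ : Bool → EuclideanSpace ℝ (Fin d) → ℝ≥0∞}

/-- The information carried by the states of depth less than `m`. -/
@[reducible] def past (gap : Label n → ℕ → Ω → ℝ) (mark : Label n → ℕ → Ω → EuclideanSpace ℝ (Fin d)) (m : ℕ) :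
    MeasurableSpace Ω :=
  ⨆ k ∈ {k : Label n × ℕ | depth k < m},
    MeasurableSpace.comap (fun ω => (gap k.1 k.2 ω, mark k.1 k.2 ω)) inferInstance

/-- A state is built only from the gaps and marks of its ancestors in the tree, all of strictly
smaller depth. -/
theorem measurable_past (hφ : ∀ b, Measurable (φ b)) (i : Fin n) (w : List Bool) :
    Measurable[past gap mark (depth (state i w))] fun ω =>
      (arrival (fun u j => gap u j ω) (state i w),
        weight φ (fun u j => mark u j ω) (state i w)) := by
  induction w with
  | nil =>
    change Measurable[past gap mark 0] fun ω => (arrival (fun u j => gap u j ω) ((i, []), 0),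
        weight φ (fun u j => mark u j ω) ((i, []), 0))
    simp only [arrival_initial, weight_initial]
    exact @measurable_const _ _ _ (_) _
  | cons b w ih =>
    rw [state_cons, depth_step]
    simp only [arrival_step, weight_step]
    generalize state i w = k at ih ⊢
    have hmono : past gap mark (depth k) ≤ past gap mark (depth k + 1) :=
      biSup_mono fun l (hl : depth l < depth k) => Nat.lt_succ_of_lt hl
    have h1 := ih.mono hmono le_rfl
    have h2 : Measurable[past gap mark (depth k + 1)]
        fun ω => (gap k.1 k.2 ω, mark k.1 k.2 ω) :=
      (comap_measurable _).mono (le_iSup₂ (f := fun (k : Label n × ℕ) (_ : k ∈ {l | depth l < _}) =>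
        MeasurableSpace.comap (fun ω => (gap k.1 k.2 ω, mark k.1 k.2 ω)) inferInstance) k
          (Nat.lt_succ_self _)) le_rfl
    have hb := hφ b
    have h3 : Measurable fun z : (ℝ × ℝ≥0∞) × (ℝ × EuclideanSpace ℝ (Fin d)) =>
        (z.1.1 + z.2.1, z.1.2 * φ b z.2.2) := by fun_prop
    exact h3.comp (h1.prodMk h2)

variable [MeasurableSpace Ω] {P : Measure Ω} {μ : Measure (EuclideanSpace ℝ (Fin d))}

theorem IsDriving.measurable_pair (h : IsDriving P μ gap mark) (k : Label n × ℕ) :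
    Measurable fun ω => (gap k.1 k.2 ω, mark k.1 k.2 ω) :=
  (h.measurable_gap _ _).prodMk (h.measurable_mark _ _)

theorem IsDriving.measurable_state (h : IsDriving P μ gap mark) (hφ : ∀ b, Measurable (φ b))
    (i : Fin n) (w : List Bool) :
    Measurable fun ω => (arrival (fun u j => gap u j ω) (state i w),
        weight φ (fun u j => mark u j ω) (state i w)) :=
  (measurable_past hφ i w).mono (iSup₂_le fun k _ => (h.measurable_pair k).comap_le) le_rfl

/-- The pair indexed by the state itself has depth not below its own, so it is not among those
generating the past. -/
theorem IsDriving.indepFun_state (h : IsDriving P μ gap mark) (hφ : ∀ b, Measurable (φ b))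
    (i : Fin n) (w : List Bool) :
    IndepFun (fun ω => (arrival (fun u j => gap u j ω) (state i w),
        weight φ (fun u j => mark u j ω) (state i w)))
      (fun ω => (gap (state i w).1 (state i w).2 ω, mark (state i w).1 (state i w).2 ω)) P := by
  rw [IndepFun_iff_Indep]
  have hind := indep_iSup_of_disjoint (fun k => (h.measurable_pair k).comap_le)
    ((iIndepFun_iff_iIndep _ _ _).1 h.indep)
    (S := {k | depth k < depth (state i w)}) (T := {state i w}) (by simp)
  refine indep_of_indep_of_le_left (indep_of_indep_of_le_right hind ?_)
    (measurable_past hφ i w).comap_le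
  simp

theorem IsDriving.measurable_current_mul_weight (h : IsDriving P μ gap mark)
    (hφ : ∀ b, Measurable (φ b)) (t : ℝ) (i : Fin n) (w : List Bool) :
    Measurable fun ω => {z : ℝ × ℝ | z.1 ≤ t ∧ t < z.1 + z.2}.indicator (1 : ℝ × ℝ → ℝ≥0∞)
          (arrival (fun u j => gap u j ω) (state i w), gap (state i w).1 (state i w).2 ω) *
        weight φ (fun u j => mark u j ω) (state i w) :=
  ((measurable_indicator_current t).comp ((h.measurable_state hφ i w).fst.prodMk
    (h.measurable_gap _ _))).mul (h.measurable_state hφ i w).snd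

variable [IsProbabilityMeasure μ]

theorem IsDriving.ae_gap_pos (h : IsDriving P μ gap mark) :
    ∀ᵐ ω ∂P, ∀ u j, 0 < gap u j ω := by
  rw [ae_all_iff]
  refine fun u => ae_all_iff.2 fun j => ?_
  refine ae_of_ae_map (h.measurable_gap u j).aemeasurable (p := fun x => 0 < x) ?_
  have hmap : P.map (gap u j) = expMeasure 1 := by
    have := congrArg Measure.fst (h.map_pair u j)
    rwa [Measure.fst_map_prodMk (h.measurable_mark u j), Measure.fst_prod] at this
  rw [hmap]
  exact ae_pos_expMeasure_one

variable [IsProbabilityMeasure P]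

theorem IsDriving.lintegral_next (h : IsDriving P μ gap mark) (hφ : ∀ b, Measurable (φ b))
    (i : Fin n) (w : List Bool) {H : (ℝ × ℝ≥0∞) × (ℝ × EuclideanSpace ℝ (Fin d)) → ℝ≥0∞}
    (hH : Measurable H) :
    ∫⁻ ω, H ((arrival (fun u j => gap u j ω) (state i w),
        weight φ (fun u j => mark u j ω) (state i w)),
        (gap (state i w).1 (state i w).2 ω, mark (state i w).1 (state i w).2 ω)) ∂P =
      ∫⁻ ω, ∫⁻ z, H ((arrival (fun u j => gap u j ω) (state i w),
        weight φ (fun u j => mark u j ω) (state i w)), z) ∂((expMeasure 1).prod μ) ∂P := by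
  have hs := h.measurable_state hφ i w
  have hp := h.measurable_pair (state i w)
  rw [← lintegral_map (f := H) hH (hs.prodMk hp),
    (indepFun_iff_map_prod_eq_prod_map_map hs.aemeasurable hp.aemeasurable).1
      (h.indepFun_state hφ i w), h.map_pair, lintegral_prod _ hH.aemeasurable,
    lintegral_map hH.lintegral_prod_right' hs]

theorem IsDriving.lintegral_next_mul (h : IsDriving P μ gap mark) (hφ : ∀ b, Measurable (φ b))
    (i : Fin n) (w : List Bool) {f : ℝ × ℝ → ℝ≥0∞} (hf : Measurable f)
    {χ : EuclideanSpace ℝ (Fin d) → ℝ≥0∞} (hχ : Measurable χ) :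
    ∫⁻ ω, f (arrival (fun u j => gap u j ω) (state i w), gap (state i w).1 (state i w).2 ω) *
        (weight φ (fun u j => mark u j ω) (state i w) *
          χ (mark (state i w).1 (state i w).2 ω)) ∂P =
      (∫⁻ y, χ y ∂μ) * ∫⁻ ω, (∫⁻ y, f (arrival (fun u j => gap u j ω) (state i w), y)
        ∂expMeasure 1) * weight φ (fun u j => mark u j ω) (state i w) ∂P := by
  have hH : Measurable fun z : (ℝ × ℝ≥0∞) × (ℝ × EuclideanSpace ℝ (Fin d)) =>
      f (z.1.1, z.2.1) * (z.1.2 * χ z.2.2) := by fun_prop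
  have hs := h.measurable_state hφ i w
  have hint : Measurable fun x => ∫⁻ y, f (x, y) ∂expMeasure 1 := hf.lintegral_prod_right'
  have hint' : Measurable fun ω => (∫⁻ y, f (arrival (fun u j => gap u j ω) (state i w), y)
      ∂expMeasure 1) * weight φ (fun u j => mark u j ω) (state i w) :=
    (hint.comp hs.fst).mul hs.snd
  rw [h.lintegral_next hφ i w hH, ← lintegral_const_mul _ hint']
  refine lintegral_congr fun ω => ?_
  generalize arrival (fun u j => gap u j ω) (state i w) = a
  generalize weight φ (fun u j => mark u j ω) (state i w) = c
  simp only
  rw [lintegral_prod_mul (f := fun y => f (a, y)) (g := fun y => c * χ y) (by fun_prop)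
    (by fun_prop), lintegral_const_mul _ hχ]
  ring

theorem IsDriving.lintegral_state (h : IsDriving P μ gap mark) (hφ : ∀ b, Measurable (φ b))
    (i : Fin n) (w : List Bool) {g : ℝ → ℝ≥0∞} (hg : Measurable g) :
    ∫⁻ ω, g (arrival (fun u j => gap u j ω) (state i w)) *
        weight φ (fun u j => mark u j ω) (state i w) ∂P =
      (w.map fun b => ∫⁻ y, φ b y ∂μ).prod * expStep^[w.length] g 0 := by
  -- The head of the word is the latest step: its gap and mark are integrated out first, which
  -- replaces `g` by `expStep g` for the shorter word.
  induction w generalizing g with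
  | nil =>
    change ∫⁻ ω, g (arrival (fun u j => gap u j ω) ((i, []), 0)) *
        weight φ (fun u j => mark u j ω) ((i, []), 0) ∂P = _
    simp only [arrival_initial, weight_initial]
    simp
  | cons b w ih =>
    simp only [state_cons, arrival_step, weight_step]
    rw [h.lintegral_next_mul hφ i w (f := fun z => g (z.1 + z.2)) (by fun_prop) (hφ b)]
    refine (congrArg (_ * ·) (ih (measurable_expStep hg))).trans ?_
    rw [List.map_cons, List.prod_cons, List.length_cons,
      Function.iterate_succ_apply, mul_assoc]

theorem IsDriving.lintegral_tsum_current (h : IsDriving P μ gap mark)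
    (hφ : ∀ b, Measurable (φ b)) (i : Fin n) (t : ℝ) :
    ∫⁻ ω, ∑' w : List Bool, {z : ℝ × ℝ | z.1 ≤ t ∧ t < z.1 + z.2}.indicator 1
          (arrival (fun u j => gap u j ω) (state i w), gap (state i w).1 (state i w).2 ω) *
        weight φ (fun u j => mark u j ω) (state i w) ∂P =
      ∑' m, (∫⁻ y, φ true y ∂μ + ∫⁻ y, φ false y ∂μ) ^ m * poissonTail t m 0 := by
  have hm := measurable_indicator_current t
  rw [lintegral_tsum fun w => (h.measurable_current_mul_weight hφ t i w).aemeasurable,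
    ← tsum_list_bool (fun b => ∫⁻ y, φ b y ∂μ) fun m => poissonTail t m 0]
  refine tsum_congr fun w => ?_
  have h1 := h.lintegral_next_mul hφ i w hm (χ := fun _ => 1) measurable_const
  simp only [mul_one, lintegral_one, measure_univ, one_mul, lintegral_indicator_expMeasure_one]
    at h1
  rw [h1, h.lintegral_state hφ i w (measurable_poissonTail t 0), iterate_expStep_poissonTail]

/-- Non-explosion: the expectation of the sum of `e^{-3 · arrival}` over a tree is the geometric
series of ratio `2 · 1/4`. The sum is thus almost surely finite, and each state arriving by time `t`
contributes at least `e^{-3t}`. -/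
theorem IsDriving.ae_finite_arrival (h : IsDriving P μ gap mark) :
    ∀ᵐ ω ∂P, ∀ t, {k : Label n × ℕ | arrival (fun u j => gap u j ω) k ≤ t}.Finite := by
  have hfin : ∀ i : Fin n, ∀ᵐ ω ∂P, ∑' w : List Bool, ENNReal.ofReal
      (Real.exp (-(3 * arrival (fun u j => gap u j ω) (state i w)))) < ∞ := fun i => by
    have hm : ∀ w, Measurable fun ω => ENNReal.ofReal
        (Real.exp (-(3 * arrival (fun u j => gap u j ω) (state i w)))) := fun w => by
      have := (h.measurable_state (φ := fun _ _ => 1) (fun _ => measurable_const) i w).fst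
      fun_prop
    refine ae_lt_top (Measurable.tsum hm) ?_
    rw [lintegral_tsum fun w => (hm w).aemeasurable]
    have h1 : ∀ w, ∫⁻ ω, ENNReal.ofReal
        (Real.exp (-(3 * arrival (fun u j => gap u j ω) (state i w)))) ∂P =
        (w.map fun _ => 1).prod * 4⁻¹ ^ w.length := fun w => by
      have := h.lintegral_state (φ := fun _ _ => 1) (fun _ => measurable_const) i w
        (g := fun x => ENNReal.ofReal (Real.exp (-(3 * x)))) (by fun_prop)
      simpa [weight_const_one, iterate_expStep_exp] using this
    rw [tsum_congr h1, tsum_list_bool (fun _ => 1) fun m => 4⁻¹ ^ m]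
    have h2 : ((1 + 1) * 4⁻¹ : ℝ≥0∞) = 2⁻¹ := by
      rw [one_add_one_eq_two, show (4 : ℝ≥0∞) = 2 * 2 by norm_num,
        ENNReal.mul_inv (by simp) (by simp), ← mul_assoc,
        ENNReal.mul_inv_cancel (by simp) (by simp), one_mul]
    simp only [← mul_pow, h2, ENNReal.tsum_geometric]
    simp
  filter_upwards [ae_all_iff.2 hfin] with ω hω t
  have hsub : {k : Label n × ℕ | arrival (fun u j => gap u j ω) k ≤ t} ⊆
      ⋃ i : Fin n, state i '' {w | ENNReal.ofReal (Real.exp (-(3 * t))) ≤ ENNReal.ofReal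
        (Real.exp (-(3 * arrival (fun u j => gap u j ω) (state i w))))} := by
    intro k (hk : _ ≤ t)
    obtain ⟨i, w, rfl⟩ := exists_state k
    refine Set.mem_iUnion.2 ⟨i, w, ENNReal.ofReal_le_ofReal (Real.exp_le_exp.2 ?_), rfl⟩
    linarith
  refine (Set.finite_iUnion fun i => Set.Finite.image _ ?_).subset hsub
  exact ENNReal.finite_const_le_of_tsum_ne_top (hω i).ne
    (ENNReal.ofReal_pos.2 (Real.exp_pos _)).ne'

theorem IsDriving.lintegral_maxSpacing_le (hn : 2 ≤ n) (x₀ : Fin n → EuclideanSpace ℝ (Fin d))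
    (h : IsDriving P μ gap mark) (hμ : Integrable (fun y : EuclideanSpace ℝ (Fin d) => ‖y‖) μ)
    {t : ℝ} (ht : 0 ≤ t) :
    ∫⁻ ω, maxSpacing x₀ (fun u j => gap u j ω) (fun u j => mark u j ω) t ∂P ≤
      (∑ a, ∑ b, edist (x₀ a) (x₀ b)) * (n * ENNReal.ofReal
        (Real.exp (-(1 - (∫ y, ‖y‖ ∂μ + ∫ y, min ‖y‖ 1 ∂μ)) * t))) := by
  have hφ : ∀ b, Measurable (spacingFactor (E := EuclideanSpace ℝ (Fin d)) b) := fun b => by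
    cases b
    · exact measurable_enorm.min measurable_const
    · exact measurable_enorm
  have htrue : ∫⁻ y, spacingFactor true y ∂μ = ENNReal.ofReal (∫ y, ‖y‖ ∂μ) := by
    rw [ofReal_integral_eq_lintegral_ofReal hμ (ae_of_all _ fun y => norm_nonneg y)]
    simp [spacingFactor]
  have hfalse : ∫⁻ y, spacingFactor false y ∂μ = ENNReal.ofReal (∫ y, min ‖y‖ 1 ∂μ) := by
    have hmin : Integrable (fun y : EuclideanSpace ℝ (Fin d) => min ‖y‖ 1) μ :=
      hμ.inf (integrable_const 1)
    rw [ofReal_integral_eq_lintegral_ofReal hmin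
      (ae_of_all _ fun y => le_min (norm_nonneg y) zero_le_one)]
    simp [spacingFactor, ENNReal.ofReal_min]
  have h0 : 0 ≤ ∫ y, ‖y‖ ∂μ := integral_nonneg fun y => norm_nonneg y
  have h0' : 0 ≤ ∫ y, min ‖y‖ 1 ∂μ :=
    integral_nonneg fun y => le_min (norm_nonneg y) zero_le_one
  have hm : ∀ i : Fin n, Measurable fun ω => ∑' w : List Bool,
      {z : ℝ × ℝ | z.1 ≤ t ∧ t < z.1 + z.2}.indicator (1 : ℝ × ℝ → ℝ≥0∞)
          (arrival (fun u j => gap u j ω) (state i w), gap (state i w).1 (state i w).2 ω) *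
        weight spacingFactor (fun u j => mark u j ω) (state i w) := fun i =>
    Measurable.tsum fun w => h.measurable_current_mul_weight hφ t i w
  refine (lintegral_mono_ae (g := fun ω => (∑ a, ∑ b, edist (x₀ a) (x₀ b)) *
      ∑ i, ∑' w : List Bool, {z : ℝ × ℝ | z.1 ≤ t ∧ t < z.1 + z.2}.indicator 1
          (arrival (fun u j => gap u j ω) (state i w), gap (state i w).1 (state i w).2 ω) *
        weight spacingFactor (fun u j => mark u j ω) (state i w)) ?_).trans ?_
  · filter_upwards [h.ae_gap_pos, h.ae_finite_arrival] with ω hgap hfin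
    exact maxSpacing_le hn hgap hfin t
  · rw [lintegral_const_mul _ (Finset.measurable_sum _ fun i _ => hm i),
      lintegral_finsetSum _ fun i _ => hm i]
    -- The same Poisson sum, with ratio `C + Ĉ`, arises for each of the `n` roots.
    simp only [h.lintegral_tsum_current hφ, htrue, hfalse, ← ENNReal.ofReal_add h0 h0',
      tsum_pow_mul_poissonTail (add_nonneg h0 h0') ht]
    simp

end Probability

end LISA

/-! ### The limit superior. -/

theorem mainTheorem7 {n₀ d : ℕ} (hn₀ : 2 ≤ n₀)
    (x₀ : Fin n₀ → EuclideanSpace ℝ (Fin d))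
    (μ : Measure (EuclideanSpace ℝ (Fin d))) [IsProbabilityMeasure μ]
    (hμ : Integrable (fun y : EuclideanSpace ℝ (Fin d) => ‖y‖) μ)
    {Ω : Type*} [MeasurableSpace Ω] (P : Measure Ω) [IsProbabilityMeasure P]
    (gap : LISA.Label n₀ → ℕ → Ω → ℝ)
    (mark : LISA.Label n₀ → ℕ → Ω → EuclideanSpace ℝ (Fin d))
    (hdriving : LISA.IsDriving P μ gap mark)
    (C Chat : ℝ) (hC : C = ∫ y, ‖y‖ ∂μ) (hChat : Chat = ∫ y, min ‖y‖ 1 ∂μ) :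
    Filter.limsup
      (fun t : ℝ => ENNReal.ofReal (Real.exp ((1 - Chat - C) * t)) *
        ∫⁻ ω, LISA.maxSpacing x₀ (fun u j => gap u j ω) (fun u j => mark u j ω) t ∂P)
      Filter.atTop < ⊤ := by
  have hD : ∑ a, ∑ b, edist (x₀ a) (x₀ b) ≠ ⊤ :=
    ENNReal.sum_ne_top.2 fun a _ => ENNReal.sum_ne_top.2 fun b _ => edist_ne_top _ _
  -- The exponentials cancel exactly, so for all `t ≥ 0` the rescaled mean is at most this constant.
  refine lt_of_le_of_lt (Filter.limsup_le_of_le (by isBoundedDefault)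
    (a := (∑ a, ∑ b, edist (x₀ a) (x₀ b)) * n₀) ?_)
    (ENNReal.mul_lt_top hD.lt_top (ENNReal.natCast_lt_top n₀))
  filter_upwards [Filter.eventually_ge_atTop 0] with t ht
  calc ENNReal.ofReal (Real.exp ((1 - Chat - C) * t)) *
        ∫⁻ ω, LISA.maxSpacing x₀ (fun u j => gap u j ω) (fun u j => mark u j ω) t ∂P
      ≤ ENNReal.ofReal (Real.exp ((1 - Chat - C) * t)) *
        ((∑ a, ∑ b, edist (x₀ a) (x₀ b)) * (n₀ * ENNReal.ofReal
          (Real.exp (-(1 - (C + Chat)) * t)))) := by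
        rw [hC, hChat]
        gcongr
        exact hdriving.lintegral_maxSpacing_le hn₀ x₀ hμ ht
    _ = (∑ a, ∑ b, edist (x₀ a) (x₀ b)) * n₀ * (ENNReal.ofReal
          (Real.exp ((1 - Chat - C) * t)) * ENNReal.ofReal
          (Real.exp (-(1 - (C + Chat)) * t))) := by ring
    _ = (∑ a, ∑ b, edist (x₀ a) (x₀ b)) * n₀ := by
        rw [← ENNReal.ofReal_mul (Real.exp_pos _).le, ← Real.exp_add,
          show (1 - Chat - C) * t + -(1 - (C + Chat)) * t = 0 by ring, Real.exp_zero,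
          ENNReal.ofReal_one, mul_one]
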